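/- Let $K=[0,1]^2$. For a closed set $S\subset K$ let $\mathcal M(S)$ be the space of bounded signed Borel measures on $\mathbb R^2$ supported in $S$, with the total-variation norm $\|\cdot\|_{\mathcal M}$. Write $\partial_1,\partial_2$ for the distributional partial derivatives on $\mathbb R^2$. Let $\mathcal M^+(K)$ be the cone of all real distributions $f\in\mathcal D'(\mathbb R^2)$ such that $\partial_1\partial_2 f\in\mathcal M(K)$, $\langle f,\varphi\rangle=0$ for every $\varphi\in C_c^\infty(\mathbb R^2\setminus K)$, and $\langle f,\varphi\rangle\ge 0$ for every $\varphi\in C_c^\infty(\mathbb R^2)$ with $\varphi\ge 0$; all such $f$ are integrable functions, and $\partial_1 f,\partial_2 f\in\mathcal M(K)$. For $n\ge 0$ let $\mathcal X_n=\{(i2^{-n},j2^{-n}) : i,j\in\{0,1,\dots,2^n\}\}$ and let $\mathcal M^+(\mathcal X_n)$ be the set of all $f\in\mathcal M^+(K)$ with $\partial_1\partial_2 f\in\mathcal M(\mathcal X_n)$. Fix an integer $N\ge 0$, data $y\in\mathbb R^{2^N\times 2^N}$, $\lambda\ge 0$ and $\theta\in(0,1]$, and define, for $f\in\mathcal M^+(K)$,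 $$\mathcal J(f)=\sum_{n_1,n_2=1}^{2^N}\Bigl(y_{n_1,n_2}-\int_{E_{n_1,n_2}} f(x)\,dx\Bigr)^2+\lambda\Bigl(\theta\,\|\partial_1\partial_2 f\|_{\mathcal M}+(1-\theta)\bigl(\|\partial_2 f\|_{\mathcal M}+\|\partial_1 f\|_{\mathcal M}\bigr)\Bigr),$$ where $E_{n_1,n_2}=\bigl[\tfrac{n_1-1}{2^N},\tfrac{n_1}{2^N}\bigr]\times\bigl[\tfrac{n_2-1}{2^N},\tfrac{n_2}{2^N}\bigr]$. Let $$\mathcal V=\operatorname*{argmin}_{f\in\mathcal M^+(K)}\mathcal J(f),\qquad \mathcal V_n=\operatorname*{argmin}_{f\in\mathcal M^+(\mathcal X_n)}\mathcal J(f).$$ Then, for all integers $N_2\ge N_1\ge N$, $$\mathcal V_{N_1}\subseteq\mathcal V_{N_2}\subseteq\mathcal V.$$ -/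

import Mathlib

open MeasureTheory TopologicalSpace
open scoped ENNReal LineDeriv

namespace MixedTV

noncomputable section

/-- Real test functions on the plane, i.e. smooth functions with compact support. -/
abbrev Test : Type := TestFunction (⊤ : Opens (ℝ × ℝ)) ℝ ⊤

/-- Real distributions on the plane. -/
abbrev Dist : Type := Distribution (⊤ : Opens (ℝ × ℝ)) ℝ ⊤

/-- The unit square `[0,1]²`. -/
def unitSquare : Set (ℝ × ℝ) := Set.Icc 0 1 ×ˢ Set.Icc 0 1

/-- The distributional derivative `D ⊗ I`. -/
def dX (f : Dist) : Dist := ∂_{((1, 0) : ℝ × ℝ)} f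

/-- The distributional derivative `I ⊗ D`. -/
def dY (f : Dist) : Dist := ∂_{((0, 1) : ℝ × ℝ)} f

/-- The mixed distributional derivative `D ⊗ D`. -/
def dXY (f : Dist) : Dist := dX (dY f)

/-- The distribution `T` is the bounded signed Borel measure `m`. -/
def IsMeasure (T : Dist) (m : SignedMeasure (ℝ × ℝ)) : Prop :=
  ∀ φ : Test, T φ = (∫ x, φ x ∂m.toJordanDecomposition.posPart)
    - ∫ x, φ x ∂m.toJordanDecomposition.negPart

/-- The bounded measure `m` is carried by `S`. -/
def CarriedBy (m : SignedMeasure (ℝ × ℝ)) (S : Set (ℝ × ℝ)) : Prop :=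
  m.totalVariation Sᶜ = 0

/-- The distribution `T` belongs to the space of bounded measures supported in `S`. -/
def MemMeasures (S : Set (ℝ × ℝ)) (T : Dist) : Prop :=
  ∃ m : SignedMeasure (ℝ × ℝ), IsMeasure T m ∧ CarriedBy m S

/-- The total-variation norm, over the unit square, of a distribution. It is the total mass
of `|m|` if `T` is a bounded measure `m` supported in the unit square (there is at most one such
`m`), and `∞` if there is no such measure. -/
def measureNorm (T : Dist) : ℝ≥0∞ :=
  ⨅ (m : SignedMeasure (ℝ × ℝ)) (_ : IsMeasure T m ∧ CarriedBy m unitSquare),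
    m.totalVariation Set.univ

/-- The native space: distributions that vanish off the unit square and whose mixed derivative
is a bounded measure supported in the unit square. -/
def nativeSpace : Set Dist :=
  {f | MemMeasures unitSquare (dXY f) ∧
    ∀ φ : Test, tsupport φ ⊆ unitSquareᶜ → f φ = 0}

/-- The cone of nonnegative elements of the native space. -/
def nativeCone : Set Dist :=
  {f | f ∈ nativeSpace ∧ ∀ φ : Test, (∀ x, 0 ≤ φ x) → 0 ≤ f φ}

/-- The dyadic grid of step `2⁻ⁿ` in the unit square, with `(2ⁿ + 1)²` knots. -/
def grid (n : ℕ) : Set (ℝ × ℝ) :=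
  {x | ∃ i j : ℕ, i ≤ 2 ^ n ∧ j ≤ 2 ^ n ∧ x = ((i : ℝ) / 2 ^ n, (j : ℝ) / 2 ^ n)}

/-- The elements of the cone whose mixed derivative is a measure supported on the grid. -/
def gridCone (n : ℕ) : Set Dist :=
  {f | f ∈ nativeCone ∧ MemMeasures (grid n) (dXY f)}

/-- The mixed norm `θ ‖(D ⊗ D) f‖ + (1 - θ) (‖(I ⊗ D) f‖ + ‖(D ⊗ I) f‖)`. -/
def mixedNorm (θ : ℝ) (f : Dist) : ℝ≥0∞ :=
  ENNReal.ofReal θ * measureNorm (dXY f)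
    + ENNReal.ofReal (1 - θ) * (measureNorm (dY f) + measureNorm (dX f))

/-- The distribution `f` is the locally integrable function `F`. -/
def IsFunction (f : Dist) (F : ℝ × ℝ → ℝ) : Prop :=
  LocallyIntegrable F volume ∧ ∀ φ : Test, f φ = ∫ x, F x * φ x

open Classical in
/-- The integral `∫_E f(x) dx` of a distribution that is a locally integrable function (this
function is unique almost everywhere); `0` for other distributions, among which there is no
element of the native space. -/
def integralOver (E : Set (ℝ × ℝ)) (f : Dist) : ℝ :=
  if h : ∃ F, IsFunction f F then ∫ x in E, h.choose x else 0

/-- The pixels at resolution `N`, indexed from `0`. -/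
def pixel (N : ℕ) (i j : Fin (2 ^ N)) : Set (ℝ × ℝ) :=
  Set.Icc ((i : ℝ) / 2 ^ N) (((i : ℝ) + 1) / 2 ^ N) ×ˢ
    Set.Icc ((j : ℝ) / 2 ^ N) (((j : ℝ) + 1) / 2 ^ N)

/-- The measurements: integrals over the pixels at resolution `N`. -/
def measurement (N : ℕ) (f : Dist) : Matrix (Fin (2 ^ N)) (Fin (2 ^ N)) ℝ :=
  fun i j => integralOver (pixel N i j) f

/-- The denoising loss `‖y - ν f‖₂² + lam ‖f‖_θ`. -/
def loss (N : ℕ) (y : Matrix (Fin (2 ^ N)) (Fin (2 ^ N)) ℝ) (lam θ : ℝ) (f : Dist) : ℝ≥0∞ :=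
  ENNReal.ofReal (∑ i, ∑ j, (y i j - measurement N f i j) ^ 2)
    + ENNReal.ofReal lam * mixedNorm θ f

/-- The minimizers of `J` over `S`. -/
def argmin (J : Dist → ℝ≥0∞) (S : Set Dist) : Set Dist :=
  {f | f ∈ S ∧ ∀ g ∈ S, J f ≤ J g}

/-- The solutions of the continuous-domain problem. -/
def solutions (N : ℕ) (y : Matrix (Fin (2 ^ N)) (Fin (2 ^ N)) ℝ) (lam θ : ℝ) : Set Dist :=
  argmin (loss N y lam θ) nativeCone

/-- The solutions of the problem discretized on the dyadic grid of step `2⁻ⁿ`. -/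
def gridSolutions (N : ℕ) (y : Matrix (Fin (2 ^ N)) (Fin (2 ^ N)) ℝ) (lam θ : ℝ) (n : ℕ) :
    Set Dist :=
  argmin (loss N y lam θ) (gridCone n)

end

end MixedTV

/-!
An element `f` of the cone is a function. Averaging `f` over the `M²` cells of side `1 / M`,
`M = 2 ^ n`, gives an element of the cone of the grid with the same integrals over the pixels at
every resolution `N ≤ n`. It remains to see that the averaging increases none of the three norms.
By summation by parts, each derivative of the average is a sum of grid-aligned probability measures:
products of unit masses at knots, in the directions of differentiation, and of uniform measures on
mesh intervals, in the others. The coefficients are divided differences of the cell integrals of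
`f`. A difference of integrals of `f` over adjacent cells is the integral, against the derivative of
`f`, of the indicator of a cell averaged along a segment of length `1 / M`. These averaged
indicators are nonnegative and their sum is at most `1`, so the derivative of the average of `f` is
the image of the derivative of `f` under a transport of mass, which does not increase the total
variation. A minimizer on a grid is therefore at least as good as every element of the full cone.
-/

namespace MixedTV

noncomputable section

section SignedMeasures

variable {X Y ι : Type*} [MeasurableSpace X] [MeasurableSpace Y]

/-- The integral of a function against a signed measure. -/
def pairing (m : SignedMeasure X) (φ : X → ℝ) : ℝ :=
  (∫ x, φ x ∂m.toJordanDecomposition.posPart) - ∫ x, φ x ∂m.toJordanDecomposition.negPart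

lemma pairing_toSignedMeasure_sub (μ ν : Measure X) [IsFiniteMeasure μ] [IsFiniteMeasure ν]
    {φ : X → ℝ} (hφ : ∀ κ : Measure X, IsFiniteMeasure κ → Integrable φ κ) :
    pairing (μ.toSignedMeasure - ν.toSignedMeasure) φ = (∫ x, φ x ∂μ) - ∫ x, φ x ∂ν := by
  set m := μ.toSignedMeasure - ν.toSignedMeasure with hm
  have jordan := m.toSignedMeasure_toJordanDecomposition
  rw [JordanDecomposition.toSignedMeasure, hm, sub_eq_sub_iff_add_eq_add, ← hm] at jordan
  have hadd : m.toJordanDecomposition.posPart + ν = μ + m.toJordanDecomposition.negPart := by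
    rwa [← Measure.toSignedMeasure_eq_toSignedMeasure_iff, Measure.toSignedMeasure_add,
      Measure.toSignedMeasure_add]
  have hint := congrArg (fun κ => ∫ x, φ x ∂κ) hadd
  simp only [integral_add_measure (hφ _ inferInstance) (hφ _ inferInstance)] at hint
  rw [pairing]
  linarith

lemma totalVariation_toSignedMeasure_sub_le (μ ν : Measure X) [IsFiniteMeasure μ]
    [IsFiniteMeasure ν] : (μ.toSignedMeasure - ν.toSignedMeasure).totalVariation ≤ μ + ν := by
  rw [SignedMeasure.totalVariation_eq_variation]
  refine VectorMeasure.variation_sub_le.trans ?_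
  rw [Measure.variation_toSignedMeasure, Measure.variation_toSignedMeasure]

/-- A finite family of nonnegative measurable functions whose sum is at most `1`. -/
structure IsSubpartition (s : Finset ι) (w : ι → X → ℝ) : Prop where
  measurable : ∀ i, Measurable (w i)
  nonneg : ∀ i x, 0 ≤ w i x
  sum_le_one : ∀ x, ∑ i ∈ s, w i x ≤ 1

lemma IsSubpartition.le_one {s : Finset ι} {w : ι → X → ℝ} (hw : IsSubpartition s w) {i : ι}
    (hi : i ∈ s) (x : X) : w i x ≤ 1 :=
  (Finset.single_le_sum (fun j _ => hw.nonneg j x) hi).trans (hw.sum_le_one x)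

/-- The image of a measure under the transport that sends a mass at `x`, in the proportions
`w i x`, to copies of the measures `ρ i`. -/
def transport (s : Finset ι) (w : ι → X → ℝ) (ρ : ι → Measure Y) (μ : Measure X) : Measure Y :=
  ∑ i ∈ s, (∫ x, w i x ∂μ).toNNReal • ρ i

instance (s : Finset ι) (w : ι → X → ℝ) (ρ : ι → Measure Y) [∀ i, IsFiniteMeasure (ρ i)]
    (μ : Measure X) : IsFiniteMeasure (transport s w ρ μ) := by
  rw [transport]
  infer_instance

variable {s : Finset ι} {w : ι → X → ℝ} {ρ : ι → Measure Y}

lemma integral_transport (hw : ∀ i x, 0 ≤ w i x) (μ : Measure X) {φ : Y → ℝ}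
    (hφ : ∀ i, Integrable φ (ρ i)) :
    ∫ y, φ y ∂transport s w ρ μ = ∑ i ∈ s, (∫ x, w i x ∂μ) * ∫ y, φ y ∂ρ i := by
  rw [transport, integral_finsetSum_measure fun i _ => (hφ i).smul_measure_nnreal]
  refine Finset.sum_congr rfl fun i _ => ?_
  rw [integral_smul_nnreal_measure, NNReal.smul_def, smul_eq_mul,
    Real.coe_toNNReal _ (integral_nonneg (hw i))]

lemma transport_apply_eq_zero (μ : Measure X) {E : Set Y} (hE : ∀ i ∈ s, ρ i E = 0) :
    transport s w ρ μ E = 0 := by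
  rw [transport, Measure.finsetSum_apply]
  exact Finset.sum_eq_zero fun i hi => by rw [Measure.smul_apply, hE i hi, smul_zero]

lemma transport_univ_le [∀ i, IsProbabilityMeasure (ρ i)] (hw : IsSubpartition s w)
    (μ : Measure X) : transport s w ρ μ Set.univ ≤ μ Set.univ := by
  calc transport s w ρ μ Set.univ = ∑ i ∈ s, ENNReal.ofReal (∫ x, w i x ∂μ) := by
        rw [transport, Measure.finsetSum_apply]
        refine Finset.sum_congr rfl fun i _ => ?_
        rw [Measure.smul_apply, measure_univ, ENNReal.smul_def, smul_eq_mul, mul_one]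
        rfl
    _ ≤ ∑ i ∈ s, ∫⁻ x, ENNReal.ofReal (w i x) ∂μ := by
        refine Finset.sum_le_sum fun i _ => ?_
        rw [integral_eq_lintegral_of_nonneg_ae (ae_of_all _ (hw.nonneg i))
          (hw.measurable i).aestronglyMeasurable]
        exact ENNReal.ofReal_toReal_le
    _ = ∫⁻ x, ENNReal.ofReal (∑ i ∈ s, w i x) ∂μ := by
        rw [← lintegral_finsetSum _ fun i _ => (hw.measurable i).ennreal_ofReal]
        simp only [ENNReal.ofReal_sum_of_nonneg fun i _ => hw.nonneg i _]
    _ ≤ ∫⁻ _, 1 ∂μ :=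
        lintegral_mono fun x => ENNReal.ofReal_le_one.2 (hw.sum_le_one x)
    _ = μ Set.univ := lintegral_one

/-- The transport of a signed measure, part by part. -/
def signedTransport (s : Finset ι) (w : ι → X → ℝ) (ρ : ι → Measure Y)
    [∀ i, IsFiniteMeasure (ρ i)] (m : SignedMeasure X) : SignedMeasure Y :=
  (transport s w ρ m.toJordanDecomposition.posPart).toSignedMeasure
    - (transport s w ρ m.toJordanDecomposition.negPart).toSignedMeasure

lemma pairing_signedTransport [∀ i, IsFiniteMeasure (ρ i)] (hw : ∀ i x, 0 ≤ w i x)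
    (m : SignedMeasure X) {φ : Y → ℝ}
    (hφ : ∀ κ : Measure Y, IsFiniteMeasure κ → Integrable φ κ) :
    pairing (signedTransport s w ρ m) φ = ∑ i ∈ s, pairing m (w i) * ∫ y, φ y ∂ρ i := by
  rw [signedTransport, pairing_toSignedMeasure_sub _ _ hφ,
    integral_transport hw _ fun i => hφ _ inferInstance,
    integral_transport hw _ fun i => hφ _ inferInstance, ← Finset.sum_sub_distrib]
  simp only [← sub_mul, pairing]

lemma totalVariation_signedTransport_eq_zero [∀ i, IsFiniteMeasure (ρ i)] (m : SignedMeasure X)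
    {E : Set Y} (hE : ∀ i ∈ s, ρ i E = 0) : (signedTransport s w ρ m).totalVariation E = 0 := by
  refine le_zero_iff.1 ((totalVariation_toSignedMeasure_sub_le _ _ E).trans_eq ?_)
  rw [Measure.add_apply, transport_apply_eq_zero _ hE, transport_apply_eq_zero _ hE, add_zero]

lemma totalVariation_signedTransport_univ_le [∀ i, IsProbabilityMeasure (ρ i)]
    (hw : IsSubpartition s w) (m : SignedMeasure X) :
    (signedTransport s w ρ m).totalVariation Set.univ ≤ m.totalVariation Set.univ :=
  (totalVariation_toSignedMeasure_sub_le _ _ _).trans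
    (add_le_add (transport_univ_le hw _) (transport_univ_le hw _))

end SignedMeasures

section Transport

variable {ι : Type*} {s : Finset ι} {w : ι → ℝ × ℝ → ℝ} {ρ : ι → Measure (ℝ × ℝ)} {T : Dist}
  {m : SignedMeasure (ℝ × ℝ)}

lemma integrable_test (φ : Test) (μ : Measure (ℝ × ℝ)) [IsFiniteMeasureOnCompacts μ] :
    Integrable φ μ := φ.continuous.integrable_of_hasCompactSupport φ.hasCompactSupport

lemma isMeasure_signedTransport [∀ i, IsFiniteMeasure (ρ i)] (hw : ∀ i x, 0 ≤ w i x)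
    (hT : ∀ φ : Test, T φ = ∑ i ∈ s, pairing m (w i) * ∫ z, φ z ∂ρ i) :
    IsMeasure T (signedTransport s w ρ m) := fun φ =>
  (hT φ).trans (pairing_signedTransport hw m fun κ _ => integrable_test φ κ).symm

lemma memMeasures_of_transport [∀ i, IsFiniteMeasure (ρ i)] (hw : ∀ i x, 0 ≤ w i x)
    (hT : ∀ φ : Test, T φ = ∑ i ∈ s, pairing m (w i) * ∫ z, φ z ∂ρ i) {S : Set (ℝ × ℝ)}
    (hρ : ∀ i ∈ s, ρ i Sᶜ = 0) : MemMeasures S T :=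
  ⟨_, isMeasure_signedTransport hw hT, totalVariation_signedTransport_eq_zero m hρ⟩

lemma measureNorm_le_of_transport [∀ i, IsProbabilityMeasure (ρ i)] (hw : IsSubpartition s w)
    (hT : ∀ φ : Test, T φ = ∑ i ∈ s, pairing m (w i) * ∫ z, φ z ∂ρ i)
    (hρ : ∀ i ∈ s, ρ i unitSquareᶜ = 0) : measureNorm T ≤ m.totalVariation Set.univ :=
  (iInf₂_le _ ⟨isMeasure_signedTransport hw.nonneg hT,
    totalVariation_signedTransport_eq_zero m hρ⟩).trans
    (totalVariation_signedTransport_univ_le hw m)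

end Transport

section SegmentAverage

open Filter Topology intervalIntegral

variable {E : Type*} [NormedAddCommGroup E] [NormedSpace ℝ E]

/-- The mean of a function over the segments `[x, x + v]`. It is an antiderivative, in the
direction `v`, of the difference `φ (x + v) - φ x`. -/
def segmentAverage (v : E) (φ : E → ℝ) (x : E) : ℝ := ∫ t in (0 : ℝ)..1, φ (x + t • v)

lemma hasLineDerivAt_segmentAverage {φ : E → ℝ} (hφ : Continuous φ) (v x : E) :
    HasLineDerivAt ℝ (segmentAverage v φ) (φ (x + v) - φ x) x v := by
  have hc : Continuous fun s : ℝ => φ (x + s • v) := by fun_prop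
  have shift : ∀ t : ℝ, segmentAverage v φ (x + t • v)
      = (∫ s in 0..(t + 1), φ (x + s • v)) - ∫ s in 0..t, φ (x + s • v) := fun t => by
    rw [integral_interval_sub_left (hc.intervalIntegrable _ _) (hc.intervalIntegrable _ _)]
    have := integral_comp_add_left (fun s => φ (x + s • v)) (a := 0) (b := 1) t
    simpa only [segmentAverage, add_zero, add_smul, ← add_assoc] using this
  have ftc : ∀ t : ℝ, HasDerivAt (fun t => ∫ s in 0..t, φ (x + s • v)) (φ (x + t • v)) t :=
    fun t => integral_hasDerivAt_right (hc.intervalIntegrable _ _)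
      (hc.stronglyMeasurableAtFilter _ _) hc.continuousAt
  have hderiv := ((ftc (0 + 1)).comp_add_const 0 1).fun_sub (ftc 0)
  simp only [HasLineDerivAt, shift]
  simpa using hderiv

lemma contDiff_segmentAverage [FiniteDimensional ℝ E] [MeasurableSpace E] [BorelSpace E]
    {φ : E → ℝ} (hφ : ContDiff ℝ (⊤ : ℕ∞) φ) (hc : HasCompactSupport φ) (v : E) :
    ContDiff ℝ (⊤ : ℕ∞) (segmentAverage v φ) := by
  -- The mean over segments is the convolution with the uniform measure on `[-v, 0]`.
  set μ : Measure E := (volume.restrict (Set.Ioc 0 1)).map fun t : ℝ => -(t • v) with hμ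
  have : IsFiniteMeasure μ := by rw [hμ]; infer_instance
  have hconv := hc.contDiff_convolution_right (μ := μ) (f := fun _ => (1 : ℝ))
    (ContinuousLinearMap.lsmul ℝ ℝ) (locallyIntegrable_const 1) hφ
  convert hconv using 1
  ext x
  have := hφ.continuous
  rw [convolution_def, hμ, integral_map (by fun_prop)
      (Continuous.aestronglyMeasurable (by simp only [ContinuousLinearMap.lsmul_apply]; fun_prop)),
    segmentAverage, integral_of_le zero_le_one]
  simp

lemma exists_isCompact_segmentAverage_eq_zero {K : Set E} (hK : IsCompact K) (v : E) :
    ∃ K', IsCompact K' ∧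
      ∀ φ : E → ℝ, (∀ x ∉ K, φ x = 0) → ∀ x ∉ K', segmentAverage v φ x = 0 := by
  refine ⟨(fun p : E × ℝ => p.1 - p.2 • v) '' (K ×ˢ Set.uIcc 0 1),
    (hK.prod isCompact_uIcc).image (by fun_prop), fun φ hφ x hx => ?_⟩
  have hzero : Set.EqOn (fun t : ℝ => φ (x + t • v)) (fun _ => 0) (Set.uIcc 0 1) := fun t ht =>
    hφ _ fun hmem => hx ⟨(x + t • v, t), ⟨hmem, ht⟩, by simp⟩
  rw [segmentAverage, integral_congr hzero, intervalIntegral.integral_zero]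

lemma hasCompactSupport_segmentAverage {φ : E → ℝ} (hc : HasCompactSupport φ) (v : E) :
    HasCompactSupport (segmentAverage v φ) :=
  have ⟨_, hK', hzero⟩ := exists_isCompact_segmentAverage_eq_zero hc.isCompact v
  HasCompactSupport.intro hK' (hzero φ fun _ => image_eq_zero_of_notMem_tsupport)

lemma segmentAverage_nonneg {φ : E → ℝ} (hφ : ∀ x, 0 ≤ φ x) (v x : E) :
    0 ≤ segmentAverage v φ x :=
  integral_nonneg zero_le_one fun _ _ => hφ _

lemma segmentAverage_le_one {φ : E → ℝ} (hφ : ∀ x, φ x ∈ Set.Icc 0 1) (v x : E) :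
    segmentAverage v φ x ≤ 1 := by
  have hnorm : ‖segmentAverage v φ x‖ ≤ 1 * |1 - 0| :=
    norm_integral_le_of_norm_le_const fun t _ => by
      rw [Real.norm_of_nonneg (hφ _).1]
      exact (hφ _).2
  simpa using (le_abs_self _).trans hnorm

lemma tendsto_segmentAverage {φ : ℕ → E → ℝ} {ψ : E → ℝ} (hφ : ∀ j, Continuous (φ j)) {C : ℝ}
    (hC : ∀ j x, ‖φ j x‖ ≤ C) (hlim : ∀ x, Tendsto (fun j => φ j x) atTop (𝓝 (ψ x)))
    (v x : E) :
    Tendsto (fun j => segmentAverage v (φ j) x) atTop (𝓝 (segmentAverage v ψ x)) :=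
  tendsto_integral_filter_of_dominated_convergence (fun _ => C)
    (Eventually.of_forall fun j => Continuous.aestronglyMeasurable (by fun_prop))
    (Eventually.of_forall fun _ => ae_of_all _ fun _ _ => hC _ _) intervalIntegrable_const
    (ae_of_all _ fun _ _ => hlim _)

lemma segmentAverage_comp_add_right (φ : E → ℝ) (v a : E) :
    segmentAverage v (fun x => φ (x + a)) = fun x => segmentAverage v φ (x + a) := by
  ext x
  simp only [segmentAverage, add_right_comm x _ a]

lemma IsSubpartition.segmentAverage {ι : Type*} [MeasurableSpace E] [BorelSpace E]
    [SecondCountableTopology E] {s : Finset ι} {w : ι → E → ℝ} (hw : IsSubpartition s w) (v : E) :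
    IsSubpartition s fun i => segmentAverage v (w i) where
  measurable i := by
    have hm : Measurable fun p : E × ℝ => w i (p.1 + p.2 • v) :=
      (hw.measurable i).comp (by fun_prop)
    have hint : Measurable fun x => ∫ t in Set.Ioc (0 : ℝ) 1, w i (x + t • v) :=
      hm.stronglyMeasurable.integral_prod_right'.measurable
    convert hint using 2
    exact integral_of_le zero_le_one
  nonneg i := segmentAverage_nonneg (hw.nonneg i) v
  sum_le_one x := by
    have hint : ∀ i ∈ s, IntervalIntegrable (fun t => w i (x + t • v)) volume 0 1 := fun i hi =>
      intervalIntegrable_const.mono_fun' (g := fun _ => 1)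
        ((hw.measurable i).comp (by fun_prop)).aestronglyMeasurable
        (ae_of_all _ fun t => by
          simpa [Real.norm_of_nonneg (hw.nonneg i _)] using hw.le_one hi (x + t • v))
    simp only [MixedTV.segmentAverage]
    rw [← integral_finsetSum hint]
    exact segmentAverage_le_one (φ := fun z => ∑ i ∈ s, w i z)
      (fun z => ⟨Finset.sum_nonneg fun i _ => hw.nonneg i z, hw.sum_le_one z⟩) v x

end SegmentAverage

section TestFunctions

lemma Test.lineDeriv_apply (φ : Test) (v z : ℝ × ℝ) : (∂_{v} φ) z = lineDeriv ℝ φ z v :=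
  TestFunction.lineDerivCLM_apply_of_le (𝕜 := ℝ) le_rfl

lemma Dist.lineDeriv_apply (f : Dist) (φ : Test) (v : ℝ × ℝ) : (∂_{v} f) φ = -f (∂_{v} φ) := by
  rw [Distribution.lineDerivOp_apply_apply, map_neg]

/-- The translate `z ↦ φ (z + a)` of a test function. -/
def Test.translate (φ : Test) (a : ℝ × ℝ) : Test where
  toFun z := φ (z + a)
  contDiff' := φ.contDiff.comp (contDiff_id.add contDiff_const)
  hasCompactSupport' := φ.hasCompactSupport.comp_homeomorph (Homeomorph.addRight a)
  tsupport_subset' _ _ := trivial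

@[simp]
lemma Test.translate_apply (φ : Test) (a z : ℝ × ℝ) : φ.translate a z = φ (z + a) := rfl

/-- `segmentAverage` as an operator on test functions. -/
def Test.segmentAverage (φ : Test) (v : ℝ × ℝ) : Test where
  toFun := MixedTV.segmentAverage v φ
  contDiff' := contDiff_segmentAverage φ.contDiff φ.hasCompactSupport v
  hasCompactSupport' := hasCompactSupport_segmentAverage φ.hasCompactSupport v
  tsupport_subset' _ _ := trivial

@[simp]
lemma Test.coe_segmentAverage (φ : Test) (v : ℝ × ℝ) :
    ⇑(φ.segmentAverage v) = MixedTV.segmentAverage v φ := rfl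

lemma Test.segmentAverage_translate (φ : Test) (v a : ℝ × ℝ) :
    (φ.translate a).segmentAverage v = (φ.segmentAverage v).translate a :=
  DFunLike.coe_injective (segmentAverage_comp_add_right φ v a)

lemma Test.smul_lineDeriv_segmentAverage (φ : Test) (v : ℝ × ℝ) (h : ℝ) :
    h • ∂_{v} (φ.segmentAverage (h • v)) = φ.translate (h • v) - φ := by
  ext z
  have hderiv := (hasLineDerivAt_segmentAverage φ.continuous (h • v) z).lineDeriv
  rw [lineDeriv_smul] at hderiv
  simpa [Test.lineDeriv_apply] using hderiv

lemma Dist.mul_lineDeriv_apply_segmentAverage (f : Dist) (φ : Test) (v : ℝ × ℝ) (h : ℝ) :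
    h * (∂_{v} f) (φ.segmentAverage (h • v)) = f φ - f (φ.translate (h • v)) := by
  rw [Dist.lineDeriv_apply, mul_neg, ← smul_eq_mul, ← map_smul,
    Test.smul_lineDeriv_segmentAverage, map_sub, neg_sub]

lemma Dist.mul_lineDeriv_lineDeriv_apply_segmentAverage (f : Dist) (φ : Test) (v w : ℝ × ℝ)
    (h : ℝ) :
    h * (h * (∂_{v} (∂_{w} f)) ((φ.segmentAverage (h • w)).segmentAverage (h • v)))
      = f φ - f (φ.translate (h • w))
        - (f (φ.translate (h • v)) - f ((φ.translate (h • v)).translate (h • w))) := by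
  rw [Dist.mul_lineDeriv_apply_segmentAverage, ← Test.segmentAverage_translate, mul_sub,
    Dist.mul_lineDeriv_apply_segmentAverage, Dist.mul_lineDeriv_apply_segmentAverage]

end TestFunctions

section Representation

lemma apply_eq_mul_dXY_segmentAverage {f : Dist}
    (hf : ∀ φ : Test, tsupport φ ⊆ unitSquareᶜ → f φ = 0) {φ : Test} {L : ℝ}
    (hφ : ∀ z ∈ tsupport φ, z.1 < L ∧ z.2 < L) :
    f φ = L * (L * dXY f ((φ.segmentAverage (L • (0, 1))).segmentAverage (L • (1, 0)))) := by
  have vanish : ∀ ψ : Test, ∀ a : ℝ × ℝ, (∀ z, ψ z = φ (z + a)) → (L ≤ a.1 ∨ L ≤ a.2) →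
      f ψ = 0 := fun ψ a hψ ha => by
    refine hf _ fun z hz hK => ?_
    rw [show ⇑ψ = φ ∘ (· + a) from funext hψ] at hz
    have hlt := hφ _ (tsupport_comp_subset_preimage φ (continuous_add_const a) hz)
    simp only [Prod.fst_add, Prod.snd_add] at hlt
    rcases ha with h | h <;> linarith [hlt.1, hlt.2, hK.1.1, hK.2.1]
  rw [dXY, dX, dY, Dist.mul_lineDeriv_lineDeriv_apply_segmentAverage,
    vanish (φ.translate _) _ (fun _ => rfl) (by simp),
    vanish (φ.translate _) _ (fun _ => rfl) (by simp),
    vanish ((φ.translate _).translate _) (L, L) (fun z => by simp [add_assoc]) (by simp)]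
  ring

lemma setIntegral_Ioi_prod_eq_mul_segmentAverage {φ : Test} {L : ℝ} (hL : 0 ≤ L)
    (hφ : ∀ z ∈ tsupport φ, z.1 < L ∧ z.2 < L) {w : ℝ × ℝ} (hw : w ∈ unitSquare) :
    ∫ z in Set.Ioi w.1 ×ˢ Set.Ioi w.2, φ z
      = L * (L * segmentAverage (L • (1, 0)) (segmentAverage (L • (0, 1)) φ) w) := by
  have truncate : ∫ z in Set.Ioi w.1 ×ˢ Set.Ioi w.2, φ z
      = ∫ z in Set.Ioc w.1 (w.1 + L) ×ˢ Set.Ioc w.2 (w.2 + L), φ z := by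
    refine setIntegral_eq_of_subset_of_forall_sdiff_eq_zero
      (measurableSet_Ioi.prod measurableSet_Ioi)
      (Set.prod_mono Set.Ioc_subset_Ioi_self Set.Ioc_subset_Ioi_self) fun z hz => ?_
    by_contra hne
    have hlt := hφ z (subset_tsupport _ hne)
    exact hz.2 ⟨⟨hz.1.1, by linarith [hlt.1, hw.1.1]⟩, ⟨hz.1.2, by linarith [hlt.2, hw.2.1]⟩⟩
  have rescale : ∀ (u : ℝ → ℝ) (a : ℝ),
      ∫ x in Set.Ioc a (a + L), u x = L * ∫ t in (0 : ℝ)..1, u (a + L * t) := fun u a => by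
    rw [← intervalIntegral.integral_of_le (by linarith), ← smul_eq_mul,
      intervalIntegral.smul_integral_comp_add_mul, mul_zero, add_zero, mul_one]
  rw [truncate, Measure.volume_eq_prod, setIntegral_prod _ (integrable_test φ _).integrableOn,
    rescale]
  simp only [rescale, segmentAverage, ← intervalIntegral.integral_const_mul]
  refine intervalIntegral.integral_congr fun t _ => ?_
  refine intervalIntegral.integral_congr fun s _ => ?_
  have shift : (w.1 + L * t, w.2 + L * s)
      = w + t • L • ((1, 0) : ℝ × ℝ) + s • L • ((0, 1) : ℝ × ℝ) := by
    ext <;> simp [mul_comm]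
  simp only [shift]

/-- The distribution function of a measure on the plane. -/
def cumul (μ : Measure (ℝ × ℝ)) (z : ℝ × ℝ) : ℝ := μ.real (Set.Iio z.1 ×ˢ Set.Iio z.2)

lemma measurableSet_prod_lt :
    MeasurableSet {p : (ℝ × ℝ) × (ℝ × ℝ) | p.2.1 < p.1.1 ∧ p.2.2 < p.1.2} :=
  ((isOpen_lt (by fun_prop) (by fun_prop)).and
    (isOpen_lt (by fun_prop) (by fun_prop))).measurableSet

lemma locallyIntegrable_cumul (μ : Measure (ℝ × ℝ)) [IsFiniteMeasure μ] :
    LocallyIntegrable (cumul μ) volume := by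
  have hm : Measurable (cumul μ) :=
    (measurable_measure_prodMk_left (ν := μ) measurableSet_prod_lt).ennreal_toReal
  refine (locallyIntegrable_const (μ.real Set.univ)).mono hm.aestronglyMeasurable
    (ae_of_all _ fun z => ?_)
  rw [cumul, Real.norm_of_nonneg measureReal_nonneg, Real.norm_of_nonneg measureReal_nonneg]
  exact measureReal_mono (Set.subset_univ _)

lemma integrable_mul_test {F : ℝ × ℝ → ℝ} (hF : LocallyIntegrable F volume) (φ : Test) :
    Integrable (fun z => F z * φ z) volume :=
  hF.integrable_smul_right_of_hasCompactSupport φ.continuous φ.hasCompactSupport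

lemma integral_cumul_mul (μ : Measure (ℝ × ℝ)) [IsFiniteMeasure μ] {φ : ℝ × ℝ → ℝ}
    (hφ : Integrable φ volume) :
    ∫ z, cumul μ z * φ z = ∫ w, (∫ z in Set.Ioi w.1 ×ˢ Set.Ioi w.2, φ z) ∂μ := by
  set Q : Set ((ℝ × ℝ) × (ℝ × ℝ)) := {p | p.2.1 < p.1.1 ∧ p.2.2 < p.1.2}
  have inner : ∀ z, ∫ w, Q.indicator (fun p => φ p.1) (z, w) ∂μ = cumul μ z * φ z := fun z => by
    rw [show (fun w => Q.indicator (fun p => φ p.1) (z, w))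
        = (Set.Iio z.1 ×ˢ Set.Iio z.2).indicator fun _ => φ z from rfl,
      integral_indicator_const _ (measurableSet_Iio.prod measurableSet_Iio)]
    rfl
  have inner' : ∀ w, ∫ z, Q.indicator (fun p => φ p.1) (z, w)
      = ∫ z in Set.Ioi w.1 ×ˢ Set.Ioi w.2, φ z := fun w => by
    rw [← integral_indicator (measurableSet_Ioi.prod measurableSet_Ioi)]
    rfl
  have fubini := integral_integral_swap (f := fun z w => Q.indicator (fun p => φ p.1) (z, w))
    ((hφ.comp_fst μ).indicator measurableSet_prod_lt)
  simpa only [inner, inner'] using fubini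

theorem exists_isFunction {f : Dist} (hf : f ∈ nativeSpace) : ∃ F, IsFunction f F := by
  obtain ⟨⟨m, hm, hmK⟩, hoff⟩ := hf
  set μ := m.toJordanDecomposition.posPart
  set ν := m.toJordanDecomposition.negPart
  obtain ⟨hμK, hνK⟩ : μ unitSquareᶜ = 0 ∧ ν unitSquareᶜ = 0 := add_eq_zero.1 hmK
  have hμ := locallyIntegrable_cumul μ
  have hν := locallyIntegrable_cumul ν
  refine ⟨cumul μ - cumul ν, hμ.sub hν, fun φ => ?_⟩
  obtain ⟨R, hR⟩ := φ.hasCompactSupport.isBounded.subset_closedBall (0 : ℝ × ℝ)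
  set L := |R| + 1
  have hL : 0 ≤ L := by positivity
  have hφ : ∀ z ∈ tsupport φ, z.1 < L ∧ z.2 < L := fun z hz => by
    have hnorm := (mem_closedBall_zero_iff.1 (hR hz)).trans (le_abs_self R)
    exact ⟨by linarith [le_abs_self z.1, norm_fst_le z, Real.norm_eq_abs z.1],
      by linarith [le_abs_self z.2, norm_snd_le z, Real.norm_eq_abs z.2]⟩
  have represent : ∀ κ : Measure (ℝ × ℝ), IsFiniteMeasure κ → κ unitSquareᶜ = 0 →
      L * (L * ∫ w, (φ.segmentAverage (L • (0, 1))).segmentAverage (L • (1, 0)) w ∂κ)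
        = ∫ z, cumul κ z * φ z := fun κ _ hκ => by
    rw [integral_cumul_mul κ (integrable_test φ volume), ← integral_const_mul,
      ← integral_const_mul]
    refine integral_congr_ae ?_
    filter_upwards [mem_ae_iff.2 hκ] with w hw
    exact (setIntegral_Ioi_prod_eq_mul_segmentAverage hL hφ hw).symm
  simp only [Pi.sub_apply, sub_mul]
  rw [apply_eq_mul_dXY_segmentAverage hoff hφ, hm, mul_sub, mul_sub,
    represent μ inferInstance hμK, represent ν inferInstance hνK,
    integral_sub (integrable_mul_test hμ φ) (integrable_mul_test hν φ)]

end Representation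

section Approximation

open Filter Topology

/-- `W` is a pointwise limit of `[0, 1]`-valued test functions with supports in a common compact
set, so that integrals of the test functions converge to those of `W`. -/
structure SmoothApprox (w : ℕ → Test) (W : ℝ × ℝ → ℝ) : Prop where
  exists_isCompact : ∃ K, IsCompact K ∧ ∀ j, ∀ z ∉ K, w j z = 0
  mem_Icc : ∀ j z, w j z ∈ Set.Icc 0 1
  tendsto : ∀ z, Tendsto (fun j => w j z) atTop (𝓝 (W z))

namespace SmoothApprox

variable {w : ℕ → Test} {W : ℝ × ℝ → ℝ}

lemma norm_le_one (hw : SmoothApprox w W) (j : ℕ) (z : ℝ × ℝ) : ‖w j z‖ ≤ 1 := by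
  rw [Real.norm_of_nonneg (hw.mem_Icc j z).1]
  exact (hw.mem_Icc j z).2

lemma translate (hw : SmoothApprox w W) (a : ℝ × ℝ) :
    SmoothApprox (fun j => (w j).translate a) fun z => W (z + a) where
  exists_isCompact := by
    obtain ⟨K, hK, hzero⟩ := hw.exists_isCompact
    exact ⟨(· + a) ⁻¹' K, (Homeomorph.addRight a).isCompact_preimage.2 hK,
      fun j z hz => hzero j _ hz⟩
  mem_Icc j z := hw.mem_Icc j _
  tendsto z := hw.tendsto _

lemma segmentAverage (hw : SmoothApprox w W) (v : ℝ × ℝ) :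
    SmoothApprox (fun j => (w j).segmentAverage v) (segmentAverage v W) where
  exists_isCompact := by
    obtain ⟨K, hK, hzero⟩ := hw.exists_isCompact
    obtain ⟨K', hK', hzero'⟩ := exists_isCompact_segmentAverage_eq_zero hK v
    exact ⟨K', hK', fun j => hzero' _ (hzero j)⟩
  mem_Icc j z := ⟨segmentAverage_nonneg (fun x => (hw.mem_Icc j x).1) v z,
    segmentAverage_le_one (hw.mem_Icc j) v z⟩
  tendsto := tendsto_segmentAverage (fun j => (w j).continuous) hw.norm_le_one hw.tendsto v

lemma tendsto_integral_mul (hw : SmoothApprox w W) {μ : Measure (ℝ × ℝ)} {F : ℝ × ℝ → ℝ}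
    (hF : LocallyIntegrable F μ) :
    Tendsto (fun j => ∫ z, F z * w j z ∂μ) atTop (𝓝 (∫ z, F z * W z ∂μ)) := by
  obtain ⟨K, hK, hzero⟩ := hw.exists_isCompact
  have hzero' : ∀ z ∉ K, W z = 0 := fun z hz =>
    tendsto_nhds_unique (hw.tendsto z) (by simp only [hzero _ z hz, tendsto_const_nhds])
  have restrict : ∀ u : ℝ × ℝ → ℝ, (∀ z ∉ K, u z = 0) →
      ∫ z in K, F z * u z ∂μ = ∫ z, F z * u z ∂μ := fun u hu =>
    setIntegral_eq_integral_of_forall_compl_eq_zero fun z hz => by rw [hu z hz, mul_zero]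
  have hFK : IntegrableOn F K μ := hF.integrableOn_isCompact hK
  rw [← restrict W hzero']
  simp only [← restrict (w _) (hzero _)]
  refine tendsto_integral_of_dominated_convergence (fun z => ‖F z‖)
    (fun j => hFK.aestronglyMeasurable.mul (w j).continuous.aestronglyMeasurable) hFK.norm
    (fun j => ae_of_all _ fun z => ?_) (ae_of_all _ fun z => (hw.tendsto z).const_mul _)
  rw [norm_mul]
  exact mul_le_of_le_one_right (norm_nonneg _) (hw.norm_le_one j z)

lemma tendsto_pairing (hw : SmoothApprox w W) (m : SignedMeasure (ℝ × ℝ)) :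
    Tendsto (fun j => pairing m (w j)) atTop (𝓝 (pairing m W)) := by
  have lim : ∀ μ : Measure (ℝ × ℝ), IsFiniteMeasure μ →
      Tendsto (fun j => ∫ z, w j z ∂μ) atTop (𝓝 (∫ z, W z ∂μ)) := fun μ _ => by
    simpa only [one_mul] using hw.tendsto_integral_mul (locallyIntegrable_const (μ := μ) 1)
  exact (lim _ inferInstance).sub (lim _ inferInstance)

lemma tendsto_apply (hw : SmoothApprox w W) {f : Dist} {F : ℝ × ℝ → ℝ} (hF : IsFunction f F) :
    Tendsto (fun j => f (w j)) atTop (𝓝 (∫ z, F z * W z)) := by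
  simpa only [hF.2] using hw.tendsto_integral_mul hF.1

lemma mul_pairing_segmentAverage (hw : SmoothApprox w W) {f : Dist} {F : ℝ × ℝ → ℝ}
    (hF : IsFunction f F) {v : ℝ × ℝ} {m : SignedMeasure (ℝ × ℝ)} (hm : IsMeasure (∂_{v} f) m)
    (h : ℝ) :
    h * pairing m (MixedTV.segmentAverage (h • v) W)
      = (∫ z, F z * W z) - ∫ z, F z * W (z + h • v) := by
  refine tendsto_nhds_unique
    (((hw.segmentAverage (h • v)).tendsto_pairing m).const_mul h)
    (((hw.tendsto_apply hF).sub ((hw.translate (h • v)).tendsto_apply hF)).congr fun j => ?_)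
  rw [← Dist.mul_lineDeriv_apply_segmentAverage, hm, pairing]

lemma mul_mul_pairing_segmentAverage_segmentAverage (hw : SmoothApprox w W) {f : Dist}
    {F : ℝ × ℝ → ℝ} (hF : IsFunction f F) {v v' : ℝ × ℝ} {m : SignedMeasure (ℝ × ℝ)}
    (hm : IsMeasure (∂_{v} (∂_{v'} f)) m) (h : ℝ) :
    h * (h * pairing m (MixedTV.segmentAverage (h • v) (MixedTV.segmentAverage (h • v') W)))
      = (∫ z, F z * W z) - (∫ z, F z * W (z + h • v'))
        - ((∫ z, F z * W (z + h • v)) - ∫ z, F z * W (z + h • v' + h • v)) := by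
  refine tendsto_nhds_unique
    (((((hw.segmentAverage (h • v')).segmentAverage (h • v)).tendsto_pairing m).const_mul
      h).const_mul h)
    ((((hw.tendsto_apply hF).sub ((hw.translate (h • v')).tendsto_apply hF)).sub
      (((hw.translate (h • v)).tendsto_apply hF).sub
        (((hw.translate (h • v)).translate (h • v')).tendsto_apply hF))).congr fun j => ?_)
  rw [← Dist.mul_lineDeriv_lineDeriv_apply_segmentAverage, hm, pairing]

end SmoothApprox

/-- A smooth step that increases from `0` to `1` on the interval `[a - 1 / (j + 1), a]`. -/
def smoothStep (a : ℝ) (j : ℕ) (x : ℝ) : ℝ := Real.smoothTransition ((j + 1) * (x - a) + 1)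

lemma contDiff_smoothStep (a : ℝ) (j : ℕ) : ContDiff ℝ (⊤ : ℕ∞) (smoothStep a j) :=
  Real.smoothTransition.contDiff.comp
    ((contDiff_const.mul (contDiff_id.sub contDiff_const)).add contDiff_const)

lemma smoothStep_mem_Icc (a : ℝ) (j : ℕ) (x : ℝ) : smoothStep a j x ∈ Set.Icc 0 1 :=
  ⟨Real.smoothTransition.nonneg _, Real.smoothTransition.le_one _⟩

lemma smoothStep_of_le {a x : ℝ} (hx : a ≤ x) (j : ℕ) : smoothStep a j x = 1 :=
  Real.smoothTransition.one_of_one_le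
    (le_add_of_nonneg_left (mul_nonneg (by positivity) (sub_nonneg.2 hx)))

lemma smoothStep_of_mul_le {a x : ℝ} {j : ℕ} (hx : 1 ≤ (j + 1) * (a - x)) :
    smoothStep a j x = 0 :=
  Real.smoothTransition.zero_of_nonpos (by linarith)

lemma tendsto_smoothStep (a x : ℝ) :
    Tendsto (fun j => smoothStep a j x) atTop (𝓝 ((Set.Ici a).indicator 1 x)) := by
  rcases le_or_gt a x with hx | hx
  · simp [Set.indicator_of_mem (Set.mem_Ici.2 hx), smoothStep_of_le hx]
  · rw [Set.indicator_of_notMem (Set.notMem_Ici.2 hx)]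
    have hlarge := (tendsto_natCast_atTop_atTop (R := ℝ)).eventually_ge_atTop (1 / (a - x))
    refine tendsto_const_nhds.congr' (hlarge.mono fun j hj => (smoothStep_of_mul_le ?_).symm)
    rw [div_le_iff₀ (sub_pos.2 hx)] at hj
    linarith

/-- A smooth bump that approximates the indicator of the interval `[a, b)`. -/
def smoothBump (a b : ℝ) (j : ℕ) (x : ℝ) : ℝ := smoothStep a j x * (1 - smoothStep b j x)

lemma contDiff_smoothBump (a b : ℝ) (j : ℕ) : ContDiff ℝ (⊤ : ℕ∞) (smoothBump a b j) :=
  (contDiff_smoothStep a j).mul (contDiff_const.sub (contDiff_smoothStep b j))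

lemma smoothBump_mem_Icc (a b : ℝ) (j : ℕ) (x : ℝ) : smoothBump a b j x ∈ Set.Icc 0 1 :=
  unitInterval.mul_mem (smoothStep_mem_Icc a j x)
    (Set.Icc.one_sub_mem (smoothStep_mem_Icc b j x))

lemma smoothBump_eq_zero_of_notMem {a b x : ℝ} (hx : x ∉ Set.Icc (a - 1) b) (j : ℕ) :
    smoothBump a b j x = 0 := by
  rw [Set.mem_Icc, not_and_or, not_le, not_le] at hx
  rcases hx with hx | hx
  · rw [smoothBump, smoothStep_of_mul_le (by nlinarith [j.cast_nonneg (α := ℝ)]), zero_mul]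
  · rw [smoothBump, smoothStep_of_le hx.le, sub_self, mul_zero]

lemma tendsto_smoothBump (a b x : ℝ) :
    Tendsto (fun j => smoothBump a b j x) atTop (𝓝 ((Set.Ico a b).indicator 1 x)) := by
  have hprod : (Set.Ico a b).indicator (1 : ℝ → ℝ) x
      = (Set.Ici a).indicator 1 x * (1 - (Set.Ici b).indicator 1 x) := by
    by_cases ha : a ≤ x <;> by_cases hb : b ≤ x <;> simp [Set.indicator, ha, hb, not_le.1]
  rw [hprod]
  exact (tendsto_smoothStep a x).mul ((tendsto_smoothStep b x).const_sub 1)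

lemma exists_smoothApprox_indicator_Ico_prod (a b c d : ℝ) :
    ∃ w, SmoothApprox w ((Set.Ico a b ×ˢ Set.Ico c d).indicator 1) := by
  have hK : IsCompact (Set.Icc (a - 1) b ×ˢ Set.Icc (c - 1) d) := isCompact_Icc.prod isCompact_Icc
  have hzero : ∀ j, ∀ z ∉ Set.Icc (a - 1) b ×ˢ Set.Icc (c - 1) d,
      smoothBump a b j z.1 * smoothBump c d j z.2 = 0 := fun j z hz => by
    rw [Set.mem_prod, not_and_or] at hz
    rcases hz with hz | hz <;> simp [smoothBump_eq_zero_of_notMem hz]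
  refine ⟨fun j => ⟨fun z => smoothBump a b j z.1 * smoothBump c d j z.2,
    ((contDiff_smoothBump a b j).comp contDiff_fst).mul
      ((contDiff_smoothBump c d j).comp contDiff_snd),
    HasCompactSupport.intro hK (hzero j), fun _ _ => trivial⟩, ⟨_, hK, hzero⟩,
    fun j z => unitInterval.mul_mem (smoothBump_mem_Icc a b j _) (smoothBump_mem_Icc c d j _),
    fun z => ?_⟩
  rw [Set.indicator_prod_one]
  exact (tendsto_smoothBump a b z.1).mul (tendsto_smoothBump c d z.2)

end Approximation

section Cells

variable (M : ℕ)

/-- The index `(k, l)` such that `(x, y)` lies in the cell `[k/M, (k+1)/M) × [l/M, (l+1)/M)`. -/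
def gridIndex (z : ℝ × ℝ) : ℤ × ℤ := (⌊z.1 * M⌋, ⌊z.2 * M⌋)

/-- The half-open interval `[k/M, (k+1)/M)`. -/
def gridInterval (k : ℤ) : Set ℝ := Set.Ico ((k : ℝ) / M) (((k + 1 : ℤ) : ℝ) / M)

/-- The half-open cell of side `1/M` with index `p`. -/
def gridCell (p : ℤ × ℤ) : Set (ℝ × ℝ) := gridInterval M p.1 ×ˢ gridInterval M p.2

/-- The indicator function of a cell. -/
def cellIndicator (p : ℤ × ℤ) : ℝ × ℝ → ℝ := (gridCell M p).indicator 1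

/-- The integral of a function over a cell. -/
def cellIntegral (F : ℝ × ℝ → ℝ) (p : ℤ × ℤ) : ℝ := ∫ z in gridCell M p, F z

lemma measurableSet_gridInterval (k : ℤ) : MeasurableSet (gridInterval M k) := measurableSet_Ico

lemma measurableSet_gridCell (p : ℤ × ℤ) : MeasurableSet (gridCell M p) :=
  (measurableSet_gridInterval M p.1).prod (measurableSet_gridInterval M p.2)

lemma cellIndicator_nonneg (p : ℤ × ℤ) (z : ℝ × ℝ) : 0 ≤ cellIndicator M p z :=
  Set.indicator_nonneg (fun _ _ => zero_le_one) z

lemma mul_cellIndicator (F : ℝ × ℝ → ℝ) (p : ℤ × ℤ) (z : ℝ × ℝ) :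
    F z * cellIndicator M p z = (gridCell M p).indicator F z := by
  rw [cellIndicator, ← Set.indicator_mul_right, Pi.one_def]
  simp only [mul_one]

lemma integral_mul_cellIndicator (F : ℝ × ℝ → ℝ) (p : ℤ × ℤ) :
    ∫ z, F z * cellIndicator M p z = cellIntegral M F p := by
  simp only [mul_cellIndicator, integral_indicator (measurableSet_gridCell M p), cellIntegral]

lemma integrableOn_gridCell {F : ℝ × ℝ → ℝ} (hF : LocallyIntegrable F volume) (p : ℤ × ℤ) :
    IntegrableOn F (gridCell M p) volume :=
  (hF.integrableOn_isCompact (isCompact_Icc.prod isCompact_Icc)).mono_set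
    (Set.prod_mono Set.Ico_subset_Icc_self Set.Ico_subset_Icc_self)

lemma exists_smoothApprox_cellIndicator (p : ℤ × ℤ) : ∃ w, SmoothApprox w (cellIndicator M p) :=
  exists_smoothApprox_indicator_Ico_prod _ _ _ _

variable {M} [NeZero M]

lemma natCast_pos_of_neZero : (0 : ℝ) < M := Nat.cast_pos.2 (NeZero.pos M)

lemma mem_Ico_div_iff {a b : ℤ} {x : ℝ} :
    x ∈ Set.Ico ((a : ℝ) / M) (b / M) ↔ ⌊x * M⌋ ∈ Finset.Ico a b := by
  rw [Set.mem_Ico, Finset.mem_Ico, Int.le_floor, Int.floor_lt,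
    div_le_iff₀ natCast_pos_of_neZero, lt_div_iff₀ natCast_pos_of_neZero]

lemma mem_Ico_div_prod_iff {a b c d : ℤ} {z : ℝ × ℝ} :
    z ∈ Set.Ico ((a : ℝ) / M) (b / M) ×ˢ Set.Ico ((c : ℝ) / M) (d / M)
      ↔ gridIndex M z ∈ Finset.Ico a b ×ˢ Finset.Ico c d := by
  rw [Set.mem_prod, mem_Ico_div_iff, mem_Ico_div_iff, Finset.mem_product, gridIndex]

lemma mem_gridCell_iff {p : ℤ × ℤ} {z : ℝ × ℝ} : z ∈ gridCell M p ↔ gridIndex M z = p := by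
  rw [gridCell, gridInterval, gridInterval, mem_Ico_div_prod_iff, Finset.mem_product,
    Finset.mem_Ico, Finset.mem_Ico, Prod.ext_iff]
  omega

lemma pairwise_disjoint_gridCell : Pairwise (Function.onFun Disjoint (gridCell M)) := fun _ _ hpq =>
  Set.disjoint_left.2 fun _ hp hq =>
    hpq ((mem_gridCell_iff.1 hp).symm.trans (mem_gridCell_iff.1 hq))

lemma Ico_div_prod_eq_biUnion_gridCell (a b c d : ℤ) :
    Set.Ico ((a : ℝ) / M) (b / M) ×ˢ Set.Ico ((c : ℝ) / M) (d / M)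
      = ⋃ p ∈ Finset.Ico a b ×ˢ Finset.Ico c d, gridCell M p := by
  ext z
  simp only [mem_Ico_div_prod_iff, Set.mem_iUnion, mem_gridCell_iff, exists_prop,
    exists_eq_right']

lemma cellIndicator_apply (p : ℤ × ℤ) (z : ℝ × ℝ) :
    cellIndicator M p z = if gridIndex M z = p then 1 else 0 := by
  simp only [cellIndicator, Set.indicator, mem_gridCell_iff, Pi.one_apply]

lemma isSubpartition_cellIndicator (s : Finset (ℤ × ℤ)) :
    IsSubpartition s (cellIndicator M) where
  measurable p := measurable_one.indicator (measurableSet_gridCell M p)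
  nonneg := cellIndicator_nonneg M
  sum_le_one z := by
    simp only [cellIndicator_apply, Finset.sum_ite_eq]
    split_ifs <;> simp

lemma gridIndex_add_inv_smul_fst (z : ℝ × ℝ) :
    gridIndex M (z + (M : ℝ)⁻¹ • (1, 0)) = gridIndex M z + (1, 0) := by
  simp [gridIndex, add_mul]

lemma gridIndex_add_inv_smul_snd (z : ℝ × ℝ) :
    gridIndex M (z + (M : ℝ)⁻¹ • (0, 1)) = gridIndex M z + (0, 1) := by
  simp [gridIndex, add_mul]

lemma cellIndicator_add_inv_smul {v : ℝ × ℝ} {e : ℤ × ℤ}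
    (hv : ∀ z, gridIndex M (z + (M : ℝ)⁻¹ • v) = gridIndex M z + e) (p : ℤ × ℤ) (z : ℝ × ℝ) :
    cellIndicator M p (z + (M : ℝ)⁻¹ • v) = cellIndicator M (p - e) z := by
  simp only [cellIndicator_apply, hv, eq_sub_iff_add_eq]

lemma setIntegral_Ico_div_prod {F : ℝ × ℝ → ℝ} (hF : LocallyIntegrable F volume) (a b c d : ℤ) :
    ∫ z in Set.Ico ((a : ℝ) / M) (b / M) ×ˢ Set.Ico ((c : ℝ) / M) (d / M), F z
      = ∑ p ∈ Finset.Ico a b ×ˢ Finset.Ico c d, cellIntegral M F p := by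
  rw [Ico_div_prod_eq_biUnion_gridCell]
  exact integral_biUnion_finset _ (fun p _ => measurableSet_gridCell M p)
    (pairwise_disjoint_gridCell.set_pairwise _) fun p _ => integrableOn_gridCell M hF p

end Cells

section CellIntegrals

variable {M : ℕ} {f : Dist} {F : ℝ × ℝ → ℝ}

lemma cellIntegral_nonneg (hF : IsFunction f F) (hpos : ∀ φ : Test, (∀ z, 0 ≤ φ z) → 0 ≤ f φ)
    (p : ℤ × ℤ) : 0 ≤ cellIntegral M F p := by
  obtain ⟨w, hw⟩ := exists_smoothApprox_cellIndicator M p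
  rw [← integral_mul_cellIndicator]
  exact ge_of_tendsto' (hw.tendsto_apply hF) fun j => hpos _ fun z => (hw.mem_Icc j z).1

lemma isClosed_unitSquare : IsClosed unitSquare := isClosed_Icc.prod isClosed_Icc

lemma ae_eq_zero_of_notMem_unitSquare (hF : IsFunction f F)
    (hoff : ∀ φ : Test, tsupport φ ⊆ unitSquareᶜ → f φ = 0) :
    ∀ᵐ z, z ∈ unitSquareᶜ → F z = 0 := by
  refine isClosed_unitSquare.isOpen_compl.ae_eq_zero_of_integral_contDiff_smul_eq_zero
    (hF.1.locallyIntegrableOn _) fun g hg hc hs => ?_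
  have hint : ∫ z, F z * g z = 0 := (hF.2 ⟨g, hg, hc, fun _ _ => trivial⟩).symm.trans (hoff _ hs)
  simpa only [smul_eq_mul, mul_comm] using hint

variable [NeZero M]

lemma cellIntegral_eq_zero (hF : IsFunction f F)
    (hoff : ∀ φ : Test, tsupport φ ⊆ unitSquareᶜ → f φ = 0) {p : ℤ × ℤ}
    (hp : p ∉ Finset.Ico (0 : ℤ) M ×ˢ Finset.Ico (0 : ℤ) M) : cellIntegral M F p = 0 := by
  have boundary : unitSquare =ᵐ[volume] Set.Ico (0 : ℝ) 1 ×ˢ Set.Ico (0 : ℝ) 1 :=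
    (Measure.set_prod_ae_eq Ico_ae_eq_Icc Ico_ae_eq_Icc).symm
  refine setIntegral_eq_zero_of_ae_eq_zero ?_
  filter_upwards [boundary.mem_iff, ae_eq_zero_of_notMem_unitSquare hF hoff] with z hz hzero hcell
  refine hzero fun hmem => hp ?_
  have hM : (M : ℝ) ≠ 0 := natCast_pos_of_neZero.ne'
  rw [← mem_gridCell_iff.1 hcell, ← mem_Ico_div_prod_iff]
  simpa [hM] using hz.1 hmem

lemma pairing_segmentAverage_cellIndicator (hF : IsFunction f F) {v : ℝ × ℝ} {e : ℤ × ℤ}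
    (hv : ∀ z, gridIndex M (z + (M : ℝ)⁻¹ • v) = gridIndex M z + e)
    {m : SignedMeasure (ℝ × ℝ)} (hm : IsMeasure (∂_{v} f) m) (p : ℤ × ℤ) :
    pairing m (segmentAverage ((M : ℝ)⁻¹ • v) (cellIndicator M p))
      = M * (cellIntegral M F p - cellIntegral M F (p - e)) := by
  obtain ⟨w, hw⟩ := exists_smoothApprox_cellIndicator M p
  have key := hw.mul_pairing_segmentAverage hF hm (M : ℝ)⁻¹
  simp only [cellIndicator_add_inv_smul hv, integral_mul_cellIndicator] at key
  rwa [← inv_mul_eq_iff_eq_mul₀ natCast_pos_of_neZero.ne']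

lemma pairing_segmentAverage_segmentAverage_cellIndicator (hF : IsFunction f F) {v v' : ℝ × ℝ}
    {e e' : ℤ × ℤ} (hv : ∀ z, gridIndex M (z + (M : ℝ)⁻¹ • v) = gridIndex M z + e)
    (hv' : ∀ z, gridIndex M (z + (M : ℝ)⁻¹ • v') = gridIndex M z + e')
    {m : SignedMeasure (ℝ × ℝ)} (hm : IsMeasure (∂_{v} (∂_{v'} f)) m) (p : ℤ × ℤ) :
    pairing m (segmentAverage ((M : ℝ)⁻¹ • v)
        (segmentAverage ((M : ℝ)⁻¹ • v') (cellIndicator M p)))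
      = M * (M * (cellIntegral M F p - cellIntegral M F (p - e'))
        - M * (cellIntegral M F (p - e) - cellIntegral M F (p - e - e'))) := by
  obtain ⟨w, hw⟩ := exists_smoothApprox_cellIndicator M p
  have key := hw.mul_mul_pairing_segmentAverage_segmentAverage hF hm (M : ℝ)⁻¹
  simp only [cellIndicator_add_inv_smul hv, cellIndicator_add_inv_smul hv',
    integral_mul_cellIndicator] at key
  rw [← mul_sub, ← inv_mul_eq_iff_eq_mul₀ natCast_pos_of_neZero.ne',
    ← inv_mul_eq_iff_eq_mul₀ natCast_pos_of_neZero.ne', key]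

end CellIntegrals

section GridMeasures

variable (M : ℕ)

/-- The uniform probability measure on the interval `[k/M, (k+1)/M)`. -/
def gridUniform (k : ℤ) : Measure ℝ := (M : ℝ≥0∞) • volume.restrict (gridInterval M k)

/-- The unit mass at the knot `k/M`. -/
def gridDirac (k : ℤ) : Measure ℝ := Measure.dirac ((k : ℝ) / M)

instance (k : ℤ) : IsProbabilityMeasure (gridDirac M k) := by
  rw [gridDirac]
  infer_instance

lemma integral_gridUniform_prod_gridUniform (φ : ℝ × ℝ → ℝ) (p : ℤ × ℤ) :
    ∫ z, φ z ∂(gridUniform M p.1).prod (gridUniform M p.2) = M * (M * cellIntegral M φ p) := by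
  rw [gridUniform, gridUniform, Measure.prod_smul_left, Measure.prod_smul_right,
    Measure.prod_restrict, integral_smul_measure, integral_smul_measure]
  simp [cellIntegral, gridCell, Measure.volume_eq_prod]

lemma integral_gridUniform_deriv {g g' : ℝ → ℝ} (hg : ∀ x, HasDerivAt g (g' x) x)
    (hg' : Continuous g') (k : ℤ) :
    ∫ x, g' x ∂gridUniform M k
      = M * ((∫ x, g x ∂gridDirac M (k + 1)) - ∫ x, g x ∂gridDirac M k) := by
  have hle : (k : ℝ) / M ≤ ((k + 1 : ℤ) : ℝ) / M := by
    gcongr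
    omega
  rw [gridUniform, integral_smul_measure, gridInterval, integral_Ico_eq_integral_Ioc,
    ← intervalIntegral.integral_of_le hle,
    intervalIntegral.integral_eq_sub_of_hasDerivAt (fun x _ => hg x) (hg'.intervalIntegrable _ _),
    gridDirac, gridDirac, integral_dirac, integral_dirac, ENNReal.toReal_natCast, smul_eq_mul]

variable [NeZero M]

instance (k : ℤ) : IsProbabilityMeasure (gridUniform M k) where
  measure_univ := by
    have hlength : ((k + 1 : ℤ) : ℝ) / M - k / M = (M : ℝ)⁻¹ := by push_cast; ring
    rw [gridUniform, Measure.smul_apply, Measure.restrict_apply_univ, gridInterval,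
      Real.volume_Ico, hlength, ENNReal.ofReal_inv_of_pos natCast_pos_of_neZero,
      ENNReal.ofReal_natCast, smul_eq_mul]
    exact ENNReal.mul_inv_cancel (Nat.cast_ne_zero.2 (NeZero.ne M)) (ENNReal.natCast_ne_top M)

variable {M}

lemma div_mem_Icc {k : ℤ} (hk : k ∈ Finset.Icc (0 : ℤ) M) : (k : ℝ) / M ∈ Set.Icc (0 : ℝ) 1 := by
  rw [Finset.mem_Icc] at hk
  have hM := natCast_pos_of_neZero (M := M)
  rw [Set.mem_Icc, le_div_iff₀ hM, div_le_iff₀ hM, zero_mul, one_mul]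
  exact_mod_cast hk

lemma gridDirac_compl_Icc {k : ℤ} (hk : k ∈ Finset.Icc (0 : ℤ) M) :
    gridDirac M k (Set.Icc 0 1)ᶜ = 0 := by
  rw [gridDirac, Measure.dirac_apply]
  exact Set.indicator_of_notMem (Set.notMem_compl_iff.2 (div_mem_Icc hk)) _

lemma gridUniform_compl_Icc {k : ℤ} (hk : k ∈ Finset.Ico (0 : ℤ) M) :
    gridUniform M k (Set.Icc 0 1)ᶜ = 0 := by
  rw [Finset.mem_Ico] at hk
  have hsub : gridInterval M k ⊆ Set.Icc 0 1 := fun x hx =>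
    ⟨(div_mem_Icc (Finset.mem_Icc.2 ⟨hk.1, hk.2.le⟩)).1.trans hx.1,
      hx.2.le.trans (div_mem_Icc (Finset.mem_Icc.2 ⟨by omega, by omega⟩)).2⟩
  rw [gridUniform, Measure.smul_apply, Measure.restrict_apply measurableSet_Icc.compl,
    Set.disjoint_iff_inter_eq_empty.1 (Set.disjoint_compl_left_iff_subset.2 hsub), measure_empty,
    smul_zero]

lemma prod_compl_unitSquare {α β : Measure ℝ} [SFinite α] [SFinite β]
    (hα : α (Set.Icc 0 1)ᶜ = 0) (hβ : β (Set.Icc 0 1)ᶜ = 0) : α.prod β unitSquareᶜ = 0 := by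
  rw [unitSquare, Set.compl_prod_eq_union]
  refine measure_union_null ?_ ?_ <;> rw [Measure.prod_prod]
  · rw [hα, zero_mul]
  · rw [hβ, mul_zero]

lemma hasDerivAt_test_comp (φ : Test) (v : ℝ × ℝ) {γ : ℝ → ℝ × ℝ} {x : ℝ}
    (hγ : HasDerivAt γ v x) : HasDerivAt (fun x => φ (γ x)) ((∂_{v} φ) (γ x)) x := by
  have hd : DifferentiableAt ℝ φ (γ x) := (φ.contDiff.differentiable (by simp)).differentiableAt
  rw [Test.lineDeriv_apply, hd.lineDeriv_eq_fderiv]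
  exact hd.hasFDerivAt.comp_hasDerivAt x hγ

lemma integral_lineDeriv_gridUniform_prod (φ : Test) (k : ℤ) (β : Measure ℝ) [IsFiniteMeasure β] :
    ∫ z, (∂_{((1, 0) : ℝ × ℝ)} φ) z ∂(gridUniform M k).prod β
      = M * ((∫ z, φ z ∂(gridDirac M (k + 1)).prod β) - ∫ z, φ z ∂(gridDirac M k).prod β) := by
  have hφ : ∀ α : Measure ℝ, IsFiniteMeasure α → Integrable φ (α.prod β) :=
    fun α _ => integrable_test φ _
  rw [integral_prod_symm _ (integrable_test _ _), integral_prod_symm _ (hφ _ inferInstance),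
    integral_prod_symm _ (hφ _ inferInstance),
    ← integral_sub (hφ _ inferInstance).integral_prod_right
      (hφ _ inferInstance).integral_prod_right, ← integral_const_mul]
  exact integral_congr_ae (ae_of_all _ fun y => integral_gridUniform_deriv M
    (fun x => hasDerivAt_test_comp φ _ ((hasDerivAt_id x).prodMk (hasDerivAt_const x y)))
    ((∂_{((1, 0) : ℝ × ℝ)} φ).continuous.comp (Continuous.prodMk_left y)) k)

lemma integral_lineDeriv_prod_gridUniform (φ : Test) (α : Measure ℝ) [IsFiniteMeasure α] (k : ℤ) :
    ∫ z, (∂_{((0, 1) : ℝ × ℝ)} φ) z ∂α.prod (gridUniform M k)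
      = M * ((∫ z, φ z ∂α.prod (gridDirac M (k + 1))) - ∫ z, φ z ∂α.prod (gridDirac M k)) := by
  have hφ : ∀ β : Measure ℝ, IsFiniteMeasure β → Integrable φ (α.prod β) :=
    fun β _ => integrable_test φ _
  rw [integral_prod _ (integrable_test _ _), integral_prod _ (hφ _ inferInstance),
    integral_prod _ (hφ _ inferInstance),
    ← integral_sub (hφ _ inferInstance).integral_prod_left
      (hφ _ inferInstance).integral_prod_left, ← integral_const_mul]
  exact integral_congr_ae (ae_of_all _ fun x => integral_gridUniform_deriv M
    (fun y => hasDerivAt_test_comp φ _ ((hasDerivAt_const y x).prodMk (hasDerivAt_id y)))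
    ((∂_{((0, 1) : ℝ × ℝ)} φ).continuous.comp (Continuous.prodMk_right x)) k)

end GridMeasures

section SummationByParts

lemma sum_Ico_mul_sub_eq (M : ℕ) {c : ℤ → ℝ} (hc₀ : c (-1) = 0) (hcM : c M = 0) (A : ℤ → ℝ) :
    ∑ k ∈ Finset.Ico (0 : ℤ) M, c k * (A (k + 1) - A k)
      = -∑ k ∈ Finset.Icc (0 : ℤ) M, (c k - c (k - 1)) * A k := by
  have same : ∑ k ∈ Finset.Ico (0 : ℤ) M, c k * A k = ∑ k ∈ Finset.Icc (0 : ℤ) M, c k * A k := by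
    rw [← Finset.Ico_insert_right (Int.natCast_nonneg M), Finset.sum_insert (by simp), hcM,
      zero_mul, zero_add]
  have shifted : ∑ k ∈ Finset.Ico (0 : ℤ) M, c k * A (k + 1)
      = ∑ k ∈ Finset.Icc (0 : ℤ) M, c (k - 1) * A k := by
    rw [← Finset.Ioc_insert_left (Int.natCast_nonneg M), Finset.sum_insert (by simp), zero_sub, hc₀,
      zero_mul, zero_add, ← Finset.Ico_add_one_add_one_eq_Ioc, ← Finset.sum_Ico_add']
    simp only [add_sub_cancel_right]
  simp only [mul_sub, sub_mul, Finset.sum_sub_distrib, same, shifted, neg_sub]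

variable {M : ℕ} [NeZero M] {T : Dist} {c : ℤ × ℤ → ℝ} {t : Finset ℤ}

lemma dX_apply_of_gridUniform {β : ℤ → Measure ℝ} [∀ l, IsFiniteMeasure (β l)]
    (hT : ∀ φ : Test, T φ = ∑ p ∈ Finset.Ico (0 : ℤ) M ×ˢ t,
      c p * ∫ z, φ z ∂(gridUniform M p.1).prod (β p.2))
    (hc₀ : ∀ l, c (-1, l) = 0) (hcM : ∀ l, c (M, l) = 0) (φ : Test) :
    dX T φ = ∑ p ∈ Finset.Icc (0 : ℤ) M ×ˢ t,
      M * (c p - c (p - (1, 0))) * ∫ z, φ z ∂(gridDirac M p.1).prod (β p.2) := by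
  rw [dX, Dist.lineDeriv_apply, hT, Finset.sum_product_right, Finset.sum_product_right,
    ← Finset.sum_neg_distrib]
  refine Finset.sum_congr rfl fun l _ => ?_
  simp only [integral_lineDeriv_gridUniform_prod, mul_left_comm (c _), mul_assoc,
    ← Finset.mul_sum]
  rw [sum_Ico_mul_sub_eq M (c := fun k => c (k, l)) (hc₀ l) (hcM l) fun k =>
    ∫ z, φ z ∂(gridDirac M k).prod (β l), mul_neg, neg_neg]
  simp only [Prod.mk_sub_mk, sub_zero]

lemma dY_apply_of_gridUniform {α : ℤ → Measure ℝ} [∀ k, IsFiniteMeasure (α k)]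
    (hT : ∀ φ : Test, T φ = ∑ p ∈ t ×ˢ Finset.Ico (0 : ℤ) M,
      c p * ∫ z, φ z ∂(α p.1).prod (gridUniform M p.2))
    (hc₀ : ∀ k, c (k, -1) = 0) (hcM : ∀ k, c (k, M) = 0) (φ : Test) :
    dY T φ = ∑ p ∈ t ×ˢ Finset.Icc (0 : ℤ) M,
      M * (c p - c (p - (0, 1))) * ∫ z, φ z ∂(α p.1).prod (gridDirac M p.2) := by
  rw [dY, Dist.lineDeriv_apply, hT, Finset.sum_product, Finset.sum_product,
    ← Finset.sum_neg_distrib]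
  refine Finset.sum_congr rfl fun k _ => ?_
  simp only [integral_lineDeriv_prod_gridUniform, mul_left_comm (c _), mul_assoc,
    ← Finset.mul_sum]
  rw [sum_Ico_mul_sub_eq M (c := fun l => c (k, l)) (hc₀ k) (hcM k) fun l =>
    ∫ z, φ z ∂(α k).prod (gridDirac M l), mul_neg, neg_neg]
  simp only [Prod.mk_sub_mk, sub_zero]

end SummationByParts

section CellAverage

/-- A function as a distribution. -/
def ofFun (G : ℝ × ℝ → ℝ) : Dist :=
  TestFunction.integralAgainstBilinCLM (ContinuousLinearMap.mul ℝ ℝ) volume G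

lemma isFunction_ofFun {G : ℝ × ℝ → ℝ} (hG : LocallyIntegrable G volume) :
    IsFunction (ofFun G) G := by
  refine ⟨hG, fun φ => (TestFunction.integralAgainstBilinCLM_eq_integral
    (hG.locallyIntegrableOn _)).trans ?_⟩
  simp only [ContinuousLinearMap.mul_apply', mul_comm]

variable (M : ℕ) (F : ℝ × ℝ → ℝ)

/-- The function that replaces `F`, on each of the `M²` cells of the unit square, by its average
over the cell. -/
def cellAverage (z : ℝ × ℝ) : ℝ :=
  ∑ p ∈ Finset.Ico (0 : ℤ) M ×ˢ Finset.Ico (0 : ℤ) M,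
    M * (M * cellIntegral M F p) * cellIndicator M p z

lemma isFunction_cellAverage : IsFunction (ofFun (cellAverage M F)) (cellAverage M F) :=
  isFunction_ofFun (integrable_finsetSum _ fun p _ => ((integrableOn_gridCell M
    (locallyIntegrable_const 1) p).integrable_indicator
      (measurableSet_gridCell M p)).const_mul _).locallyIntegrable

lemma ofFun_cellAverage_apply (φ : Test) :
    ofFun (cellAverage M F) φ = ∑ p ∈ Finset.Ico (0 : ℤ) M ×ˢ Finset.Ico (0 : ℤ) M,
      cellIntegral M F p * ∫ z, φ z ∂(gridUniform M p.1).prod (gridUniform M p.2) := by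
  have expand : ∀ z, cellAverage M F z * φ z
      = ∑ p ∈ Finset.Ico (0 : ℤ) M ×ˢ Finset.Ico (0 : ℤ) M,
        M * (M * cellIntegral M F p) * (φ z * cellIndicator M p z) := fun z => by
    rw [cellAverage, Finset.sum_mul]
    exact Finset.sum_congr rfl fun p _ => by ring
  have integrable_mul (p : ℤ × ℤ) : Integrable (fun z => φ z * cellIndicator M p z) volume := by
    simp only [mul_cellIndicator]
    exact (integrable_test φ volume).indicator (measurableSet_gridCell M p)
  rw [(isFunction_cellAverage M F).2]
  simp only [expand]
  rw [integral_finsetSum _ fun p _ => (integrable_mul p).const_mul _]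
  refine Finset.sum_congr rfl fun p _ => ?_
  rw [integral_const_mul, integral_mul_cellIndicator, integral_gridUniform_prod_gridUniform]
  ring

variable {M F} [NeZero M]

lemma cellIntegral_cellAverage {p : ℤ × ℤ}
    (hp : p ∈ Finset.Ico (0 : ℤ) M ×ˢ Finset.Ico (0 : ℤ) M) :
    cellIntegral M (cellAverage M F) p = cellIntegral M F p := by
  have average_eq : ∀ z ∈ gridCell M p, cellAverage M F z = cellIntegral M F p * (M * (M * 1)) :=
    fun z hz => by
      simp only [cellAverage, cellIndicator_apply, mem_gridCell_iff.1 hz, mul_ite, mul_one,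
        mul_zero, Finset.sum_ite_eq, if_pos hp]
      ring
  have volume_cell : M * (M * cellIntegral M (fun _ => 1) p) = 1 := by
    rw [← integral_gridUniform_prod_gridUniform, integral_const, probReal_univ, one_smul]
  rw [cellIntegral, setIntegral_congr_fun (measurableSet_gridCell M p) average_eq,
    integral_const_mul, integral_const_mul, integral_const_mul, ← cellIntegral, volume_cell,
    mul_one]

variable {f : Dist}

lemma dX_cellAverage_apply (hF : IsFunction f F)
    (hoff : ∀ φ : Test, tsupport φ ⊆ unitSquareᶜ → f φ = 0) {m : SignedMeasure (ℝ × ℝ)}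
    (hm : IsMeasure (dX f) m) (φ : Test) :
    dX (ofFun (cellAverage M F)) φ = ∑ p ∈ Finset.Icc (0 : ℤ) M ×ˢ Finset.Ico (0 : ℤ) M,
      pairing m (segmentAverage ((M : ℝ)⁻¹ • (1, 0)) (cellIndicator M p))
        * ∫ z, φ z ∂(gridDirac M p.1).prod (gridUniform M p.2) := by
  simp only [pairing_segmentAverage_cellIndicator hF gridIndex_add_inv_smul_fst hm]
  exact dX_apply_of_gridUniform (ofFun_cellAverage_apply M F)
    (fun l => cellIntegral_eq_zero hF hoff (by simp))
    (fun l => cellIntegral_eq_zero hF hoff (by simp)) φ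

lemma dY_cellAverage_apply (hF : IsFunction f F)
    (hoff : ∀ φ : Test, tsupport φ ⊆ unitSquareᶜ → f φ = 0) {m : SignedMeasure (ℝ × ℝ)}
    (hm : IsMeasure (dY f) m) (φ : Test) :
    dY (ofFun (cellAverage M F)) φ = ∑ p ∈ Finset.Ico (0 : ℤ) M ×ˢ Finset.Icc (0 : ℤ) M,
      pairing m (segmentAverage ((M : ℝ)⁻¹ • (0, 1)) (cellIndicator M p))
        * ∫ z, φ z ∂(gridUniform M p.1).prod (gridDirac M p.2) := by
  simp only [pairing_segmentAverage_cellIndicator hF gridIndex_add_inv_smul_snd hm]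
  exact dY_apply_of_gridUniform (ofFun_cellAverage_apply M F)
    (fun l => cellIntegral_eq_zero hF hoff (by simp))
    (fun l => cellIntegral_eq_zero hF hoff (by simp)) φ

lemma dXY_cellAverage_apply (hF : IsFunction f F)
    (hoff : ∀ φ : Test, tsupport φ ⊆ unitSquareᶜ → f φ = 0) {m : SignedMeasure (ℝ × ℝ)}
    (hm : IsMeasure (dXY f) m) (φ : Test) :
    dXY (ofFun (cellAverage M F)) φ = ∑ p ∈ Finset.Icc (0 : ℤ) M ×ˢ Finset.Icc (0 : ℤ) M,
      pairing m (segmentAverage ((M : ℝ)⁻¹ • (1, 0))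
          (segmentAverage ((M : ℝ)⁻¹ • (0, 1)) (cellIndicator M p)))
        * ∫ z, φ z ∂(gridDirac M p.1).prod (gridDirac M p.2) := by
  simp only [pairing_segmentAverage_segmentAverage_cellIndicator hF gridIndex_add_inv_smul_fst
    gridIndex_add_inv_smul_snd hm]
  have hdY := dY_apply_of_gridUniform (ofFun_cellAverage_apply M F)
    (fun k => cellIntegral_eq_zero hF hoff (by simp))
    (fun k => cellIntegral_eq_zero hF hoff (by simp))
  have hzero : ∀ k l : ℤ, k ∉ Finset.Ico (0 : ℤ) M →
      (M : ℝ) * (cellIntegral M F (k, l) - cellIntegral M F ((k, l) - (0, 1))) = 0 :=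
    fun k l hk => by
      rw [cellIntegral_eq_zero hF hoff, cellIntegral_eq_zero hF hoff, sub_zero, mul_zero] <;>
        simp_all
  exact dX_apply_of_gridUniform hdY (fun l => hzero _ l (by simp)) (fun l => hzero _ l (by simp)) φ

end CellAverage

section Norms

variable {M : ℕ} [NeZero M] {f : Dist} {F : ℝ × ℝ → ℝ}

lemma measureNorm_dX_cellAverage_le (hF : IsFunction f F)
    (hoff : ∀ φ : Test, tsupport φ ⊆ unitSquareᶜ → f φ = 0) :
    measureNorm (dX (ofFun (cellAverage M F))) ≤ measureNorm (dX f) :=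
  le_iInf₂ fun _ hm => measureNorm_le_of_transport
    ((isSubpartition_cellIndicator _).segmentAverage _) (dX_cellAverage_apply hF hoff hm.1)
    fun _ hp => prod_compl_unitSquare (gridDirac_compl_Icc (Finset.mem_product.1 hp).1)
      (gridUniform_compl_Icc (Finset.mem_product.1 hp).2)

lemma measureNorm_dY_cellAverage_le (hF : IsFunction f F)
    (hoff : ∀ φ : Test, tsupport φ ⊆ unitSquareᶜ → f φ = 0) :
    measureNorm (dY (ofFun (cellAverage M F))) ≤ measureNorm (dY f) :=
  le_iInf₂ fun _ hm => measureNorm_le_of_transport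
    ((isSubpartition_cellIndicator _).segmentAverage _) (dY_cellAverage_apply hF hoff hm.1)
    fun _ hp => prod_compl_unitSquare (gridUniform_compl_Icc (Finset.mem_product.1 hp).1)
      (gridDirac_compl_Icc (Finset.mem_product.1 hp).2)

lemma measureNorm_dXY_cellAverage_le (hF : IsFunction f F)
    (hoff : ∀ φ : Test, tsupport φ ⊆ unitSquareᶜ → f φ = 0) :
    measureNorm (dXY (ofFun (cellAverage M F))) ≤ measureNorm (dXY f) :=
  le_iInf₂ fun _ hm => measureNorm_le_of_transport
    (((isSubpartition_cellIndicator _).segmentAverage _).segmentAverage _)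
    (dXY_cellAverage_apply hF hoff hm.1)
    fun _ hp => prod_compl_unitSquare (gridDirac_compl_Icc (Finset.mem_product.1 hp).1)
      (gridDirac_compl_Icc (Finset.mem_product.1 hp).2)

end Norms

section Grid

lemma MemMeasures.mono {S S' : Set (ℝ × ℝ)} (hS : S ⊆ S') {T : Dist} (hT : MemMeasures S T) :
    MemMeasures S' T := by
  obtain ⟨m, hm, hcarried⟩ := hT
  exact ⟨m, hm, measure_mono_null (Set.compl_subset_compl.2 hS) hcarried⟩

lemma mem_grid_of_mem_Icc {n : ℕ} {p : ℤ × ℤ}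
    (hp : p ∈ Finset.Icc (0 : ℤ) (2 ^ n : ℕ) ×ˢ Finset.Icc (0 : ℤ) (2 ^ n : ℕ)) :
    ((p.1 : ℝ) / (2 ^ n : ℕ), (p.2 : ℝ) / (2 ^ n : ℕ)) ∈ grid n := by
  obtain ⟨k, l⟩ := p
  simp only [Finset.mem_product, Finset.mem_Icc] at hp
  obtain ⟨⟨hk, hkn⟩, hl, hln⟩ := hp
  lift k to ℕ using hk
  lift l to ℕ using hl
  exact ⟨k, l, by exact_mod_cast hkn, by exact_mod_cast hln, by push_cast; rfl⟩

lemma grid_subset_unitSquare (n : ℕ) : grid n ⊆ unitSquare := by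
  rintro _ ⟨i, j, hi, hj, rfl⟩
  have div_mem : ∀ {i : ℕ}, i ≤ 2 ^ n → (i : ℝ) / 2 ^ n ∈ Set.Icc (0 : ℝ) 1 := fun {i} hi =>
    ⟨by positivity, div_le_one_of_le₀ (by exact_mod_cast hi) (by positivity)⟩
  exact ⟨div_mem hi, div_mem hj⟩

lemma div_two_pow_eq (n d : ℕ) (x : ℝ) : x / 2 ^ n = x * 2 ^ d / 2 ^ (n + d) := by
  rw [pow_add, mul_div_mul_right _ _ (by positivity)]

lemma grid_mono {n n' : ℕ} (hn : n ≤ n') : grid n ⊆ grid n' := by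
  rintro _ ⟨i, j, hi, hj, rfl⟩
  obtain ⟨d, rfl⟩ := Nat.exists_eq_add_of_le hn
  refine ⟨i * 2 ^ d, j * 2 ^ d, ?_, ?_, ?_⟩
  · rw [pow_add]
    exact Nat.mul_le_mul_right _ hi
  · rw [pow_add]
    exact Nat.mul_le_mul_right _ hj
  · push_cast
    rw [div_two_pow_eq n d, div_two_pow_eq n d]

lemma gridCone_mono {n n' : ℕ} (hn : n ≤ n') : gridCone n ⊆ gridCone n' :=
  fun _ hf => ⟨hf.1, hf.2.mono (grid_mono hn)⟩

variable {f : Dist} {F : ℝ × ℝ → ℝ}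

theorem cellAverage_mem_gridCone (hF : IsFunction f F) (hf : f ∈ nativeCone) (n : ℕ) :
    ofFun (cellAverage (2 ^ n) F) ∈ gridCone n := by
  obtain ⟨⟨⟨m, hm, -⟩, hoff⟩, hpos⟩ := hf
  have hgrid : MemMeasures (grid n) (dXY (ofFun (cellAverage (2 ^ n) F))) :=
    memMeasures_of_transport
      (fun p => segmentAverage_nonneg (segmentAverage_nonneg (cellIndicator_nonneg _ p) _) _)
      (dXY_cellAverage_apply hF hoff hm) fun p hp => by
        rw [gridDirac, gridDirac, Measure.dirac_prod_dirac, Measure.dirac_apply]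
        exact Set.indicator_of_notMem (Set.notMem_compl_iff.2 (mem_grid_of_mem_Icc hp)) _
  refine ⟨⟨⟨hgrid.mono (grid_subset_unitSquare n), fun φ hφ => ?_⟩, fun φ hφ => ?_⟩, hgrid⟩ <;>
    rw [ofFun_cellAverage_apply]
  · refine Finset.sum_eq_zero fun p hp => mul_eq_zero_of_right _ (integral_eq_zero_of_ae ?_)
    have hnull := prod_compl_unitSquare (gridUniform_compl_Icc (Finset.mem_product.1 hp).1)
      (gridUniform_compl_Icc (Finset.mem_product.1 hp).2)
    filter_upwards [mem_ae_iff.2 hnull] with z hz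
    exact image_eq_zero_of_notMem_tsupport fun hmem => hφ hmem hz
  · exact Finset.sum_nonneg fun p _ =>
      mul_nonneg (cellIntegral_nonneg hF hpos p) (integral_nonneg hφ)

end Grid

section Measurements

variable {f : Dist} {F : ℝ × ℝ → ℝ}

lemma ae_eq_of_isFunction {G : ℝ × ℝ → ℝ} (hF : IsFunction f F) (hG : IsFunction f G) :
    F =ᵐ[volume] G := by
  refine ae_eq_of_integral_contDiff_smul_eq hF.1 hG.1 fun g hg hc => ?_
  have hint : ∫ z, F z * g z = ∫ z, G z * g z :=
    (hF.2 ⟨g, hg, hc, fun _ _ => trivial⟩).symm.trans (hG.2 ⟨g, hg, hc, fun _ _ => trivial⟩)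
  simpa only [smul_eq_mul, mul_comm] using hint

lemma integralOver_eq (hF : IsFunction f F) (E : Set (ℝ × ℝ)) :
    integralOver E f = ∫ z in E, F z := by
  have hrepr : ∃ F, IsFunction f F := ⟨F, hF⟩
  rw [integralOver, dif_pos hrepr]
  exact integral_congr_ae (ae_restrict_of_ae (ae_eq_of_isFunction hrepr.choose_spec hF))

/-- The indices, in the direction of either axis, of the cells of side `2⁻⁽ᴺ⁺ᵈ⁾` contained in the
pixels with index `i` at resolution `N`. -/
def pixelIndices {N : ℕ} (d : ℕ) (i : Fin (2 ^ N)) : Finset ℤ :=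
  Finset.Ico ((i : ℤ) * 2 ^ d) (((i : ℤ) + 1) * 2 ^ d)

lemma pixelIndices_subset {N : ℕ} (d : ℕ) (i : Fin (2 ^ N)) :
    pixelIndices d i ⊆ Finset.Ico (0 : ℤ) (2 ^ (N + d) : ℕ) := by
  refine Finset.Ico_subset_Ico (by positivity) ?_
  have hi : (i : ℤ) + 1 ≤ 2 ^ N := by exact_mod_cast i.2
  push_cast
  rw [pow_add]
  gcongr

lemma setIntegral_pixel (hF : LocallyIntegrable F volume) {N : ℕ} (d : ℕ) (i j : Fin (2 ^ N)) :
    ∫ z in pixel N i j, F z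
      = ∑ p ∈ pixelIndices d i ×ˢ pixelIndices d j, cellIntegral (2 ^ (N + d)) F p := by
  rw [pixelIndices, pixelIndices, ← setIntegral_Ico_div_prod hF, pixel]
  push_cast
  simp only [← div_two_pow_eq]
  exact setIntegral_congr_set (Measure.set_prod_ae_eq Ico_ae_eq_Icc Ico_ae_eq_Icc).symm

lemma measurement_cellAverage (hF : IsFunction f F) (N d : ℕ) :
    measurement N (ofFun (cellAverage (2 ^ (N + d)) F)) = measurement N f := by
  ext i j
  have hG := isFunction_cellAverage (2 ^ (N + d)) F
  rw [measurement, measurement, integralOver_eq hF, integralOver_eq hG, setIntegral_pixel hF.1 d,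
    setIntegral_pixel hG.1 d]
  exact Finset.sum_congr rfl fun p hp => cellIntegral_cellAverage
    (Finset.product_subset_product (pixelIndices_subset d i) (pixelIndices_subset d j) hp)

end Measurements

theorem exists_mem_gridCone_loss_le {N n : ℕ} (hn : N ≤ n)
    (y : Matrix (Fin (2 ^ N)) (Fin (2 ^ N)) ℝ) (lam θ : ℝ) {f : Dist} (hf : f ∈ nativeCone) :
    ∃ g ∈ gridCone n, loss N y lam θ g ≤ loss N y lam θ f := by
  obtain ⟨F, hF⟩ := exists_isFunction hf.1
  obtain ⟨d, rfl⟩ := Nat.exists_eq_add_of_le hn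
  refine ⟨_, cellAverage_mem_gridCone hF hf (N + d), ?_⟩
  rw [loss, loss, measurement_cellAverage hF, mixedNorm, mixedNorm]
  gcongr
  · exact measureNorm_dXY_cellAverage_le hF hf.1.2
  · exact measureNorm_dY_cellAverage_le hF hf.1.2
  · exact measureNorm_dX_cellAverage_le hF hf.1.2

end

end MixedTV

theorem mainTheorem3 (N : ℕ) (y : Matrix (Fin (2 ^ N)) (Fin (2 ^ N)) ℝ) (lam θ : ℝ)
    (hlam : 0 ≤ lam) (hθ : 0 < θ) (hθ' : θ ≤ 1) (N₁ N₂ : ℕ) (h₁ : N ≤ N₁) (h₂ : N₁ ≤ N₂) :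
    MixedTV.gridSolutions N y lam θ N₁ ⊆ MixedTV.gridSolutions N y lam θ N₂ ∧
      MixedTV.gridSolutions N y lam θ N₂ ⊆ MixedTV.solutions N y lam θ := by
  refine ⟨fun f hf => ⟨MixedTV.gridCone_mono h₂ hf.1, fun g hg => ?_⟩,
    fun f hf => ⟨hf.1.1, fun g hg => ?_⟩⟩
  · obtain ⟨g', hg', hle⟩ := MixedTV.exists_mem_gridCone_loss_le h₁ y lam θ hg.1
    exact (hf.2 g' hg').trans hle
  · obtain ⟨g', hg', hle⟩ := MixedTV.exists_mem_gridCone_loss_le (h₁.trans h₂) y lam θ hg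
    exact (hf.2 g' hg').trans hle
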